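/- Let $n\ge 4$ be an integer and let $\Gamma$ be a finite group. Let $K_n^\Gamma$ be the multigraph with vertex set $\{1,\dots,n\}$ and edge set $\binom{[n]}{2}\times\Gamma$, where for $i<j$ and $\gamma\in\Gamma$ the edge $(\{i,j\},\gamma)$ joins $i$ and $j$, is oriented from $i$ to $j$, and has label $\gamma$. A cycle of $K_n^\Gamma$ (two parallel edges count as a cycle) is called balanced if the oriented product of its edge labels along a traversal of the cycle, in which an edge that is traversed against its orientation contributes the inverse of its label, is the identity of $\Gamma$. Let $M(K_n^\Gamma)$ be the cycle matroid of $K_n^\Gamma$. Let $M$ be a matroid on the edge set $E$ of $K_n^\Gamma$ such that (i) $M$ is a lift of $M(K_n^\Gamma)$, i.e. there are a set $F$ disjoint from $E$ and a matroid $K$ on $E\cup F$ with $K/F=M(K_n^\Gamma)$ and $K\setminus F=M$; and (ii) a cycle of $K_n^\Gamma$ is a circuit of $M$ if and only if it is balanced. If $r(M)-r(M(K_n^\Gamma))>1$, then there are a prime $p$ and an integer $j\ge 2$ such that $\Gamma\cong\mathbb{Z}_p^j$, the direct sum of $j$ copies of the cyclic group of order $p$. -/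

import Mathlib

universe u

/-! ### Cycles of a multigraph -/

namespace Graph

variable {α β : Type*}

/-- `v 0, e 0, v 1, e 1, …, v k, e k, v 0` is a traversal of a cycle of `G` with `k + 1` edges: the
vertices are distinct, the edges are distinct, and `e i` joins `v i` to `v (i + 1)`, with indices
modulo `k + 1`. A loop is a cycle (`k = 0`), and so is a pair of parallel edges (`k = 1`). -/
def IsCycleTraversal (G : Graph α β) {k : ℕ} (v : Fin (k + 1) → α) (e : Fin (k + 1) → β) : Prop :=
  Function.Injective v ∧ Function.Injective e ∧ ∀ i, G.IsLink (e i) (v i) (v (i + 1))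

/-- `C` is the edge set of a cycle of `G`. -/
def IsCycle (G : Graph α β) (C : Set β) : Prop :=
  ∃ (k : ℕ) (v : Fin (k + 1) → α) (e : Fin (k + 1) → β),
    G.IsCycleTraversal v e ∧ Set.range e = C

/-- A set of edges of `G` that contains no cycle of `G` (the edge set of a forest). -/
def IsForest (G : Graph α β) (I : Set β) : Prop :=
  I ⊆ G.edgeSet ∧ ∀ C ⊆ I, ¬ G.IsCycle C

/-! ### The forests of a multigraph satisfy the matroid axioms -/

theorem IsCycle.subset_edgeSet {G : Graph α β} {C : Set β} (hC : G.IsCycle C) :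
    C ⊆ G.edgeSet := by
  obtain ⟨k, v, e, h, rfl⟩ := hC
  rintro _ ⟨i, rfl⟩
  exact (h.2.2 i).edge_mem

open Classical in
/-- The column of an edge in the incidence matrix of `G` over the two-element field. -/
noncomputable def incVec (G : Graph α β) (e : β) : α →₀ ZMod 2 :=
  if h : ∃ p : α × α, G.IsLink e p.1 p.2 then
    Finsupp.single h.choose.1 1 + Finsupp.single h.choose.2 1 else 0

theorem IsLink.incVec_eq {G : Graph α β} {e : β} {x y : α} (h : G.IsLink e x y) :
    G.incVec e = Finsupp.single x 1 + Finsupp.single y 1 := by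
  have h' : ∃ p : α × α, G.IsLink e p.1 p.2 := ⟨(x, y), h⟩
  rw [incVec, dif_pos h']
  obtain ⟨h1, h2⟩ | ⟨h1, h2⟩ := h'.choose_spec.eq_and_eq_or_eq_and_eq h
  · rw [h1, h2]
  · rw [h1, h2, add_comm]

theorem IsCycleTraversal.sum_incVec {G : Graph α β} {k : ℕ} {v : Fin (k + 1) → α}
    {e : Fin (k + 1) → β} (h : G.IsCycleTraversal v e) : ∑ i, G.incVec (e i) = 0 := by
  have h1 : ∀ i, G.incVec (e i) = Finsupp.single (v i) 1 + Finsupp.single (v (i + 1)) 1 :=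
    fun i => (h.2.2 i).incVec_eq
  have h2 : ∑ i, (Finsupp.single (v (i + 1)) 1 : α →₀ ZMod 2) = ∑ i, Finsupp.single (v i) 1 :=
    Equiv.sum_comp (Equiv.addRight (1 : Fin (k + 1)))
      (fun i => (Finsupp.single (v i) 1 : α →₀ ZMod 2))
  rw [Finset.sum_congr rfl fun i _ => h1 i, Finset.sum_add_distrib, h2]
  ext x
  exact CharTwo.add_self_eq_zero _

/-- If adding `e` to the forest `I` creates a cycle, then `e` is dependent on `I` over the
two-element field. -/
theorem IsForest.incVec_mem_span {G : Graph α β} {I : Set β} (hI : G.IsForest I) {e : β}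
    (he : e ∈ G.edgeSet) (hIe : ¬ G.IsForest (insert e I)) :
    G.incVec e ∈ Submodule.span (ZMod 2) (G.incVec '' I) := by
  have hC : ∃ C ⊆ insert e I, G.IsCycle C := by
    by_contra! hcon
    exact hIe ⟨Set.insert_subset he hI.1, hcon⟩
  obtain ⟨C, hCI, hC⟩ := hC
  have heC : e ∈ C := by
    by_contra heC
    exact hI.2 C (fun f hf => (hCI hf).resolve_left fun hfe => heC (hfe ▸ hf)) hC
  obtain ⟨k, v, f, h, rfl⟩ := hC
  obtain ⟨i, rfl⟩ := heC
  have hsum := h.sum_incVec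
  rw [← Finset.add_sum_erase _ _ (Finset.mem_univ i)] at hsum
  rw [eq_neg_of_add_eq_zero_left hsum]
  refine neg_mem (Submodule.sum_mem _ fun j hj => Submodule.subset_span ⟨f j, ?_, rfl⟩)
  refine (hCI ⟨j, rfl⟩).resolve_left fun hji => ?_
  exact Finset.ne_of_mem_erase hj (h.2.1 hji)

/-- The simple graph in which two vertices are adjacent if they are joined by an edge in `J`. -/
def underlying (G : Graph α β) (J : Set β) : SimpleGraph α where
  Adj x y := x ≠ y ∧ ∃ e ∈ J, G.IsLink e x y
  symm := ⟨fun _ _ h => ⟨h.1.symm, h.2.imp fun _ he => ⟨he.1, he.2.symm⟩⟩⟩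
  loopless := ⟨fun _ h => h.1 rfl⟩

/-- An edge whose ends are connected in `J` completes a cycle with edges of `J`. -/
theorem exists_isCycle_of_reachable {G : Graph α β} {J : Set β} {e : β} {x y : α}
    (he : G.IsLink e x y) (heJ : e ∉ J) (h : (G.underlying J).Reachable x y) :
    ∃ C ⊆ insert e J, G.IsCycle C := by
  classical
  have : Nonempty β := ⟨e⟩
  obtain ⟨p, hp⟩ := h.exists_isPath
  have hadj : ∀ i : ℕ, i < p.length → ∃ f ∈ J, G.IsLink f (p.getVert i) (p.getVert (i + 1)) :=
    fun i hi => (p.adj_getVert_succ hi).2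
  choose! f hfJ hf using hadj
  have hinj : ∀ i j : ℕ, i ≤ p.length → j ≤ p.length → p.getVert i = p.getVert j → i = j :=
    fun i j hi hj hij => hp.getVert_injOn hi hj hij
  refine ⟨Set.range fun i : Fin (p.length + 1) => if (i : ℕ) < p.length then f i else e, ?_,
    p.length, fun i => p.getVert i, _, ⟨?_, ?_, ?_⟩, rfl⟩
  · rintro _ ⟨i, rfl⟩
    by_cases hi : (i : ℕ) < p.length
    · simpa [hi] using Or.inr (hfJ i hi)
    · simp [hi]
  · intro i j hij
    exact Fin.ext (hinj i j (by omega) (by omega) hij)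
  · intro i j hij
    ext
    by_cases hi : (i : ℕ) < p.length <;> by_cases hj : (j : ℕ) < p.length
    · simp only [hi, hj, if_true] at hij
      have h1 := hf i hi
      rw [hij] at h1
      obtain ⟨h2, -⟩ | ⟨h2, h3⟩ := h1.eq_and_eq_or_eq_and_eq (hf j hj)
      · exact hinj _ _ hi.le hj.le h2
      · have h4 := hinj _ _ hi.le (by omega) h2
        have h5 := hinj _ _ (by omega) hj.le h3
        omega
    · simp only [hi, hj, if_true, if_false] at hij
      exact absurd (hij ▸ hfJ i hi) heJ
    · simp only [hi, hj, if_true, if_false] at hij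
      exact absurd (hij ▸ hfJ j hj) heJ
    · omega
  · intro i
    by_cases hi : (i : ℕ) < p.length
    · have h1 : ((i + 1 : Fin (p.length + 1)) : ℕ) = i + 1 := by
        rw [Fin.val_add_one_of_lt]
        exact Fin.lt_def.2 (by simpa using hi)
      simpa [hi, h1] using hf i hi
    · have h0 : i = Fin.last _ := Fin.ext (by simp; omega)
      subst h0
      simpa using he.symm

/-- The incidence vectors of a finite forest are linearly independent. -/
theorem IsForest.linearIndepOn {G : Graph α β} {J : Set β} (hfin : J.Finite) (hJ : G.IsForest J) :
    LinearIndepOn (ZMod 2) G.incVec J := by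
  classical
  induction J, hfin using Set.Finite.induction_on with
  | empty => exact linearIndepOn_empty _ _
  | @insert e J heJ _ ih =>
    have hJ' : G.IsForest J :=
      ⟨(Set.subset_insert e J).trans hJ.1, fun C hC => hJ.2 C (hC.trans (Set.subset_insert e J))⟩
    refine (linearIndepOn_insert heJ).2 ⟨ih hJ', fun hspan => ?_⟩
    obtain ⟨x, y, hxy⟩ := G.exists_isLink_of_mem_edgeSet (hJ.1 (Set.mem_insert e J))
    have hnr : ¬ (G.underlying J).Reachable x y := fun h => by
      obtain ⟨C, hC, hC'⟩ := exists_isCycle_of_reachable hxy heJ h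
      exact hJ.2 C hC hC'
    let φ : (α →₀ ZMod 2) →ₗ[ZMod 2] ZMod 2 :=
      Finsupp.lsum (ZMod 2) fun z =>
        if (G.underlying J).Reachable x z then LinearMap.id else 0
    have hφ : ∀ z, φ (Finsupp.single z 1) = if (G.underlying J).Reachable x z then 1 else 0 := by
      intro z
      by_cases hz : (G.underlying J).Reachable x z <;> simp [φ, hz]
    have hker : Submodule.span (ZMod 2) (G.incVec '' J) ≤ LinearMap.ker φ := by
      rw [Submodule.span_le]
      rintro _ ⟨f, hf, rfl⟩
      obtain ⟨a, b, hab⟩ := G.exists_isLink_of_mem_edgeSet (hJ'.1 hf)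
      have hiff : (G.underlying J).Reachable x a ↔ (G.underlying J).Reachable x b := by
        by_cases hne : a = b
        · rw [hne]
        · have hadj : (G.underlying J).Adj a b := ⟨hne, f, hf, hab⟩
          exact ⟨fun h => h.trans hadj.reachable, fun h => h.trans hadj.symm.reachable⟩
      rw [SetLike.mem_coe, LinearMap.mem_ker, hab.incVec_eq, map_add, hφ, hφ]
      simp only [hiff]
      exact CharTwo.add_self_eq_zero _
    have h0 := LinearMap.mem_ker.1 (hker hspan)
    rw [hxy.incVec_eq, map_add, hφ, hφ] at h0
    simp [hnr] at h0

theorem IsForest.augment {G : Graph α β} {I J : Set β} (hI : G.IsForest I) (hIfin : I.Finite)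
    (hJ : G.IsForest J) (hJfin : J.Finite) (hIJ : I.ncard < J.ncard) :
    ∃ e ∈ J, e ∉ I ∧ G.IsForest (insert e I) := by
  by_contra! hcon
  have hle : Submodule.span (ZMod 2) (G.incVec '' J) ≤
      Submodule.span (ZMod 2) (G.incVec '' I) := by
    rw [Submodule.span_le]
    rintro _ ⟨e, he, rfl⟩
    by_cases heI : e ∈ I
    · exact Submodule.subset_span ⟨e, heI, rfl⟩
    · exact hI.incVec_mem_span (hJ.1 he) (hcon e he heI)
  have hIind := hI.linearIndepOn hIfin
  have hJind := hJ.linearIndepOn hJfin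
  have := hIfin.fintype
  have := hJfin.fintype
  have hfd : FiniteDimensional (ZMod 2) (Submodule.span (ZMod 2) (G.incVec '' I)) :=
    FiniteDimensional.span_of_finite _ (hIfin.image _)
  have h := Submodule.finrank_mono hle
  rw [Set.image_eq_range, Set.image_eq_range, finrank_span_eq_card hIind,
    finrank_span_eq_card hJind] at h
  rw [← Nat.card_coe_set_eq, ← Nat.card_coe_set_eq, Nat.card_eq_fintype_card,
    Nat.card_eq_fintype_card] at hIJ
  omega

/-- The cycle matroid `M(G)`: its ground set is the edge set of `G`, and a set of edges is
independent if and only if it contains no cycle of `G`. -/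
def cycleMatroid (G : Graph α β) : Matroid β :=
  (IndepMatroid.ofFinitaryCardAugment G.edgeSet G.IsForest
    ⟨Set.empty_subset _, by
      rintro C hC ⟨k, v, e, -, rfl⟩
      exact hC ⟨0, rfl⟩⟩
    (fun _ _ hJ hIJ => ⟨hIJ.trans hJ.1, fun C hC => hJ.2 C (hC.trans hIJ)⟩)
    (fun _ _ hI hIfin hJ hJfin hIJ => hI.augment hIfin hJ hJfin hIJ)
    (by
      refine fun I h => ⟨fun e he => ?_, fun C hC hcyc => ?_⟩
      · exact (h {e} (by simpa using he) (Set.finite_singleton e)).1 rfl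
      · have hfin : C.Finite := by
          obtain ⟨k, v, e, -, rfl⟩ := hcyc
          exact Set.finite_range e
        exact (h C hC hfin).2 C subset_rfl hcyc)
    fun _ hI => hI.1).matroid

@[simp] theorem cycleMatroid_ground (G : Graph α β) : G.cycleMatroid.E = G.edgeSet := rfl

@[simp] theorem cycleMatroid_indep_iff (G : Graph α β) {I : Set β} :
    G.cycleMatroid.Indep I ↔ G.IsForest I := Iff.rfl

end Graph

/-! ### Gain graphs -/

/-- A gain graph: a multigraph together with, for each edge, an orientation (a tail and a head) and
a label in the group `Γ`. -/
structure GainGraph (α β Γ : Type*) where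
  graph : Graph α β
  tail : β → α
  head : β → α
  gain : β → Γ
  isLink_tail_head : ∀ e ∈ graph.edgeSet, graph.IsLink e (tail e) (head e)

namespace GainGraph

variable {α β Γ : Type*} [Group Γ]

open Classical in
/-- The gain of the edge `e` when it is traversed starting from its end `x`: the label of `e` if
`x` is the tail of `e`, and the inverse of the label otherwise. -/
noncomputable def gainFrom (G : GainGraph α β Γ) (x : α) (e : β) : Γ :=
  if x = G.tail e then G.gain e else (G.gain e)⁻¹

/-- `C` is the edge set of a balanced cycle: along a traversal of the cycle, the oriented product
of the edge labels is the identity. (Which traversal is taken does not matter: another one changes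
the product to a conjugate of itself or of its inverse.) -/
def IsBalancedCycle (G : GainGraph α β Γ) (C : Set β) : Prop :=
  ∃ (k : ℕ) (v : Fin (k + 1) → α) (e : Fin (k + 1) → β),
    G.graph.IsCycleTraversal v e ∧ Set.range e = C ∧
      (List.ofFn fun i => G.gainFrom (v i) (e i)).prod = 1

end GainGraph

/-- The edges of the full `Γ`-gain graph on `n` vertices: pairs of a two-element set `{i, j}` of
vertices, written as the ordered pair `(i, j)` with `i < j`, and an element of `Γ`. -/
abbrev FullEdge (n : ℕ) (Γ : Type u) : Type u := {p : Fin n × Fin n // p.1 < p.2} × Γ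

/-- The full `Γ`-gain graph on `n` vertices: for all vertices `i < j` and each `γ` in `Γ`
there is one edge between `i` and `j` that is oriented from `i` to `j` and labelled `γ`. -/
def fullGainGraph (n : ℕ) (Γ : Type u) : GainGraph (Fin n) (FullEdge n Γ) Γ where
  graph :=
    { vertexSet := Set.univ
      edgeSet := Set.univ
      IsLink := fun e x y => (x = e.1.1.1 ∧ y = e.1.1.2) ∨ (x = e.1.1.2 ∧ y = e.1.1.1)
      isLink_symm := fun _ _ => ⟨fun _ _ h => by tauto⟩
      eq_or_eq_of_isLink_of_isLink := by
        rintro e x y v w (⟨rfl, -⟩ | ⟨rfl, -⟩) (⟨rfl, rfl⟩ | ⟨rfl, rfl⟩) <;> simp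
      edge_mem_iff_exists_isLink := fun e =>
        iff_of_true (Set.mem_univ e) ⟨_, _, Or.inl ⟨rfl, rfl⟩⟩
      left_mem_of_isLink := fun _ _ _ _ => Set.mem_univ _ }
  tail := fun e => e.1.1.1
  head := fun e => e.1.1.2
  gain := fun e => e.2
  isLink_tail_head := fun _ _ => Or.inl ⟨rfl, rfl⟩

/-! ### Lifts of matroids -/

open scoped Matroid in
/-- `L` is a lift of `M`: there are a set `F` disjoint from the common ground set `E` of `L` and `M`
and a matroid `K` on `E ∪ F` with `K ／ F = M` and `K ＼ F = L`. Disjointness is arranged by taking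
`K` on the disjoint sum `α ⊕ F`, in which `α` and `F` are the ranges of `Sum.inl` and `Sum.inr`. -/
def Matroid.IsLift {α : Type u} (L M : Matroid α) : Prop :=
  ∃ (F : Type u) (K : Matroid (α ⊕ F)),
    K ／ Set.range Sum.inr = M.map Sum.inl Sum.inl_injective.injOn ∧
    K ＼ Set.range Sum.inr = L.map Sum.inl Sum.inl_injective.injOn

/-! Fix four vertices. For each `a`, the labels on the line of `M` through the parallel edges
labelled `1` and `a` form a set `S a`. Balanced triangles are circuits, so labels can be multiplied
inside closed sets of `M`: a third vertex makes `S a` a subgroup (`lineSubgroup`), and a fourth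
makes it normal (`lineSubgroup_normal`). Auxiliary edges to these vertices do no harm, because
closure in `M` is contained in closure in the cycle matroid, where an edge alone in a cut is not
spanned.

Unbalanced digons are not circuits, so two lines sharing a nonidentity label coincide
(`lineSubgroup_eq`). If some `S a` were all of `Γ`, the rank would rise by at most one
(`eRank_le_of_line`). Hence proper normal subgroups partition the nonidentity elements of `Γ`, and
this forces `Γ` to be elementary abelian (`exists_mulEquiv_of_normal_partition`). -/

/-! ### Group theory: partitions into normal subgroups. -/

/-- A finite vector space over the field with `p` elements is a direct sum of cyclic groups. -/
theorem exists_addEquiv_of_module_zmod (p : ℕ) [Fact p.Prime] (V : Type*) [AddCommGroup V]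
    [Module (ZMod p) V] [Finite V] : ∃ j : ℕ, Nonempty (V ≃+ (Fin j → ZMod p)) :=
  have : Module.Finite (ZMod p) V := Module.Finite.of_finite
  ⟨_, ⟨(Module.finBasis (ZMod p) V).equivFun.toAddEquiv⟩⟩

/-- A finite abelian group of prime exponent `p` is a direct sum of cyclic groups of order `p`. -/
theorem exists_mulEquiv_of_pow_eq_one {Γ : Type*} [CommGroup Γ] [Finite Γ] {p : ℕ} [Fact p.Prime]
    (h : ∀ x : Γ, x ^ p = 1) : ∃ j : ℕ, Nonempty (Γ ≃* Multiplicative (Fin j → ZMod p)) := by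
  let hmod : Module (ZMod p) (Additive Γ) :=
    AddCommGroup.zmodModule fun x => by
      rw [← ofMul_toMul x, ← ofMul_pow, h, ofMul_one]
  obtain ⟨j, ⟨e⟩⟩ := exists_addEquiv_of_module_zmod p (Additive Γ)
  exact ⟨j, ⟨AddEquiv.toMultiplicativeRight e⟩⟩

/-- A finite group with a family of proper normal subgroups that partition the nontrivial elements
is elementary abelian of rank at least two. -/
theorem exists_mulEquiv_of_normal_partition {Γ : Type*} [Group Γ] [Finite Γ] (S : Γ → Subgroup Γ)
    (hnormal : ∀ a, (S a).Normal) (hmem : ∀ a, a ∈ S a) (htop : ∀ a, S a ≠ ⊤)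
    (heq : ∀ a b, b ≠ 1 → b ∈ S a → S b = S a) :
    ∃ p j : ℕ, p.Prime ∧ 2 ≤ j ∧ Nonempty (Γ ≃* Multiplicative (Fin j → ZMod p)) := by
  -- Distinct members of the partition are normal and meet trivially, so they centralize each other.
  have hcomm1 : ∀ a b, b ∉ S a → Commute a b := by
    intro a b hb
    refine Subgroup.commute_of_normal_of_disjoint (S a) (S b) (hnormal a) (hnormal b) ?_ a b
      (hmem a) (hmem b)
    rw [Subgroup.disjoint_def]
    intro x hxa hxb
    by_contra hx
    exact hb (heq a x hx hxa ▸ heq b x hx hxb ▸ hmem b)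
  have hcompl : ∀ a, ∃ b, b ∉ S a := fun a => by
    by_contra! h
    exact htop a ((Subgroup.eq_top_iff' _).2 h)
  have hcomm : ∀ a b : Γ, a * b = b * a := by
    intro a b
    by_cases hb1 : b = 1
    · simp [hb1]
    by_cases hb : b ∈ S a
    -- With `c` outside `S a`, so is `a * c`; since `b` commutes with both, it commutes with `a`.
    · obtain ⟨c, hc⟩ := hcompl a
      have hSb := heq a b hb1 hb
      have h1 : Commute b c := hcomm1 b c (hSb ▸ hc)
      have h2 : Commute b (a * c) := hcomm1 b (a * c) fun h =>
        hc (((S a).mul_mem_cancel_left (hmem a)).1 (hSb ▸ h))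
      have h3 := h2.mul_right h1.inv_right
      rw [mul_inv_cancel_right] at h3
      exact h3.symm.eq
    · exact hcomm1 a b hb
  let _ : CommGroup Γ := { ‹Group Γ› with mul_comm := hcomm }
  have : Nontrivial Γ := by
    obtain ⟨b, hb⟩ := hcompl 1
    exact ⟨b, 1, fun h => hb (h.symm ▸ hmem 1)⟩
  obtain ⟨p, hp, hpc⟩ := Nat.exists_prime_and_dvd (Finite.one_lt_card (α := Γ)).ne'
  have : Fact p.Prime := ⟨hp⟩
  obtain ⟨a, ha⟩ := exists_prime_orderOf_dvd_card' p hpc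
  have hap : a ^ p = 1 := ha ▸ pow_orderOf_eq_one a
  have ha1 : a ≠ 1 := fun h => hp.one_lt.ne (by rw [← ha, h, orderOf_one])
  -- Here `(a * b) ^ p = b ^ p`. If this were nontrivial, `S b` and `S (a * b)` would coincide and
  -- contain `a`.
  have hout : ∀ b, b ∉ S a → b ^ p = 1 := by
    intro b hb
    by_contra hbp
    have h1 := heq b _ hbp (pow_mem (hmem b) p)
    have h2 := heq (a * b) (b ^ p) hbp (by
      have := pow_mem (hmem (a * b)) p
      rwa [mul_pow, hap, one_mul] at this)
    have h3 : a ∈ S b := ((S b).mul_mem_cancel_right (hmem b)).1 (h1 ▸ h2 ▸ hmem (a * b))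
    exact hb (heq b a ha1 h3 ▸ hmem b)
  have hexp : ∀ c : Γ, c ^ p = 1 := by
    intro c
    by_cases hc : c ∈ S a
    · obtain ⟨b, hb⟩ := hcompl a
      have h := hout (c * b) fun h => hb (((S a).mul_mem_cancel_left hc).1 h)
      rwa [mul_pow, hout b hb, mul_one] at h
    · exact hout c hc
  obtain ⟨j, ⟨E⟩⟩ := exists_mulEquiv_of_pow_eq_one hexp
  refine ⟨p, j, hp, ?_, ⟨E⟩⟩
  -- For `j < 2` the nontrivial group `Γ` has order `p`, leaving no room for the proper nontrivial
  -- subgroup `S a`.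
  by_contra! hlt
  have hcard : Nat.card Γ = p ^ j := by
    rw [Nat.card_congr E.toEquiv, Nat.card_congr Multiplicative.toAdd]
    simp
  have h1 : Nat.card Γ = p := by
    have := Finite.one_lt_card (α := Γ)
    interval_cases j
    · simp_all
    · simpa using hcard
  have : Fact (Nat.card Γ).Prime := ⟨h1 ▸ hp⟩
  obtain h | h := (S a).eq_bot_or_eq_top_of_prime_card
  · exact ha1 (by simpa [h] using hmem a)
  · exact htop a h

/-! ### Closures in a matroid and in its lifts. -/

namespace Matroid

variable {α : Type*}

theorem IsCircuit.mem_closure_of_forall {M : Matroid α} {C X : Set α} {e : α} (hC : M.IsCircuit C)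
    (he : e ∈ C) (h : ∀ f ∈ C, f ≠ e → f ∈ M.closure X) : e ∈ M.closure X :=
  M.closure_subset_closure_of_subset_closure (fun f hf => h f hf.1 hf.2)
    (hC.mem_closure_sdiff_singleton_of_mem he)

/-- Deleting from a spanning set an element that the quotient `N` of `M` separates from the rest. -/
theorem mem_closure_of_mem_closure_insert {M N : Matroid α}
    (hMN : ∀ X, M.closure X ⊆ N.closure X) {X : Set α} {e z : α}
    (hz : z ∉ N.closure (insert e X)) (he : e ∈ M.closure (insert z X)) : e ∈ M.closure X := by
  by_contra hcon
  -- Otherwise exchange puts `z` in the `M`-closure, hence in the `N`-closure, of `insert e X`.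
  exact hz (hMN _ (M.closure_exchange ⟨he, hcon⟩).1)

end Matroid

namespace Matroid.IsLift

variable {α : Type u} {L M : Matroid α}

theorem ground_eq (h : L.IsLift M) : L.E = M.E := by
  obtain ⟨F, K, h1, h2⟩ := h
  have h3 := congrArg Matroid.E h1
  have h4 := congrArg Matroid.E h2
  rw [Matroid.contract_ground, Matroid.map_ground] at h3
  rw [Matroid.delete_ground, Matroid.map_ground] at h4
  exact Sum.inl_injective.image_injective (h4.symm.trans h3)

/-- Off `F`, the two sides are the closures in `K` of `X` and of `X ∪ F`. Together with `ground_eq`,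
this is all the proof uses about lifts. -/
theorem closure_subset (h : L.IsLift M) (X : Set α) : L.closure X ⊆ M.closure X := by
  obtain ⟨F, K, h1, h2⟩ := h
  have h3 := congrArg (fun N => N.closure (Sum.inl '' X)) h1
  have h4 := congrArg (fun N => N.closure (Sum.inl '' X)) h2
  have hdisj : Disjoint (Sum.inl '' X : Set (α ⊕ F)) (Set.range Sum.inr) := by
    rw [Set.disjoint_left]
    rintro _ ⟨x, -, rfl⟩ ⟨y, hy⟩
    simp at hy
  simp only [Matroid.contract_closure_eq, Matroid.map_closure_eq,
    Set.preimage_image_eq _ Sum.inl_injective] at h3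
  simp only [Matroid.delete_closure_eq_of_disjoint _ hdisj, Matroid.map_closure_eq,
    Set.preimage_image_eq _ Sum.inl_injective] at h4
  refine (Set.image_subset_image_iff (Sum.inl_injective (β := F))).1 ?_
  rw [← h3, ← h4]
  exact Set.sdiff_subset_sdiff_left (K.closure_subset_closure Set.subset_union_left)

end Matroid.IsLift

/-! ### Cuts, digons and balanced triangles of the full gain graph. -/

section FullGainGraph

variable {n : ℕ} {Γ : Type u}

/-- The edge from `i` to `j` with label `γ` in the full `Γ`-gain graph. -/
abbrev fullEdge {i j : Fin n} (h : i < j) (γ : Γ) : FullEdge n Γ := (⟨(i, j), h⟩, γ)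

theorem fullGainGraph_isLink (e : FullEdge n Γ) :
    (fullGainGraph n Γ).graph.IsLink e e.1.1.1 e.1.1.2 := Or.inl ⟨rfl, rfl⟩

/-- An edge in the cut of a vertex set `A` is not spanned by edges outside of this cut. -/
theorem notMem_closure_of_cut (A : Set (Fin n)) {Z : Set (FullEdge n Γ)} {z : FullEdge n Γ}
    (hz : ¬ (z.1.1.1 ∈ A ↔ z.1.1.2 ∈ A)) (hZ : ∀ e ∈ Z, (e.1.1.1 ∈ A ↔ e.1.1.2 ∈ A)) :
    z ∉ (fullGainGraph n Γ).graph.cycleMatroid.closure Z := by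
  classical
  intro hmem
  obtain ⟨I, hI⟩ := (fullGainGraph n Γ).graph.cycleMatroid.exists_isBasis Z (Set.subset_univ Z)
  rw [← hI.closure_eq_closure, hI.indep.mem_closure_iff] at hmem
  have hzI : z ∉ I := fun h => hz (hZ z (hI.subset h))
  have hspan := Graph.IsForest.incVec_mem_span hI.indep (Set.mem_univ z)
    (hmem.resolve_right hzI).not_indep
  -- Summing the coordinates in `A` modulo 2 gives 1 on edges crossing the cut and 0 on all others.
  let φ : (Fin n →₀ ZMod 2) →ₗ[ZMod 2] ZMod 2 :=
    Finsupp.lsum (ZMod 2) fun x => if x ∈ A then LinearMap.id else 0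
  have hφ : ∀ x, φ (Finsupp.single x 1) = if x ∈ A then 1 else 0 := by
    intro x
    by_cases hx : x ∈ A <;> simp [φ, hx]
  have hker : Submodule.span (ZMod 2) ((fullGainGraph n Γ).graph.incVec '' I) ≤
      LinearMap.ker φ := by
    rw [Submodule.span_le]
    rintro _ ⟨f, hf, rfl⟩
    rw [SetLike.mem_coe, LinearMap.mem_ker, (fullGainGraph_isLink f).incVec_eq, map_add, hφ, hφ]
    simp only [hZ f (hI.subset hf)]
    exact CharTwo.add_self_eq_zero _
  have h0 := LinearMap.mem_ker.1 (hker hspan)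
  rw [(fullGainGraph_isLink z).incVec_eq, map_add, hφ, hφ] at h0
  by_cases h1 : z.1.1.1 ∈ A <;> by_cases h2 : z.1.1.2 ∈ A <;> simp_all

theorem fullGainGraph_isCycle_digon {i j : Fin n} (hij : i < j) {a b : Γ} (hab : a ≠ b) :
    (fullGainGraph n Γ).graph.IsCycle {fullEdge hij a, fullEdge hij b} := by
  refine ⟨1, ![i, j], ![fullEdge hij a, fullEdge hij b], ⟨?_, ?_, ?_⟩, ?_⟩
  · intro x y h
    fin_cases x <;> fin_cases y <;> simp_all [hij.ne, hij.ne']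
  · intro x y h
    fin_cases x <;> fin_cases y <;> simp_all [hab.symm]
  · intro x
    fin_cases x
    · exact Or.inl ⟨rfl, rfl⟩
    · exact Or.inr ⟨rfl, rfl⟩
  · ext x
    simp
    tauto

variable [Group Γ]

theorem fullGainGraph_gainFrom_left {i j : Fin n} (h : i < j) (γ : Γ) :
    (fullGainGraph n Γ).gainFrom i (fullEdge h γ) = γ := by
  simp [GainGraph.gainFrom, fullGainGraph]

theorem fullGainGraph_gainFrom_right {i j : Fin n} (h : i < j) (γ : Γ) :
    (fullGainGraph n Γ).gainFrom j (fullEdge h γ) = γ⁻¹ := by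
  simp [GainGraph.gainFrom, fullGainGraph, h.ne']

theorem fullGainGraph_isBalancedCycle_triangle {i j k : Fin n} (hij : i < j) (hjk : j < k)
    (a b : Γ) : (fullGainGraph n Γ).IsBalancedCycle
      {fullEdge hij a, fullEdge hjk b, fullEdge (hij.trans hjk) (a * b)} := by
  refine ⟨2, ![i, j, k], ![fullEdge hij a, fullEdge hjk b, fullEdge (hij.trans hjk) (a * b)],
    ⟨?_, ?_, ?_⟩, ?_, ?_⟩
  · intro x y h
    fin_cases x <;> fin_cases y <;>
      simp_all [hij.ne, hij.ne', hjk.ne, hjk.ne', (hij.trans hjk).ne, (hij.trans hjk).ne']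
  · intro x y h
    fin_cases x <;> fin_cases y <;>
      simp_all [hij.ne, hij.ne', hjk.ne, hjk.ne']
  · intro x
    fin_cases x
    · exact Or.inl ⟨rfl, rfl⟩
    · exact Or.inl ⟨rfl, rfl⟩
    · exact Or.inr ⟨rfl, rfl⟩
  · ext x
    simp
    tauto
  · simp [List.ofFn_succ, fullGainGraph_gainFrom_left, fullGainGraph_gainFrom_right]

theorem fullGainGraph_not_isBalancedCycle_digon {i j : Fin n} (hij : i < j) {a b : Γ}
    (hab : a ≠ b) :
    ¬ (fullGainGraph n Γ).IsBalancedCycle {fullEdge hij a, fullEdge hij b} := by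
  rintro ⟨k, v, e, ⟨-, he, hlink⟩, hr, hprod⟩
  have hne : fullEdge hij a ≠ fullEdge hij b := fun h => hab (congrArg Prod.snd h)
  have hk : k = 1 := by
    have h := congrArg Set.ncard hr
    rw [Set.ncard_pair hne, ← Set.image_univ, Set.ncard_image_of_injective _ he,
      Set.ncard_univ, Nat.card_fin] at h
    omega
  subst hk
  have hmem : ∀ x, e x = fullEdge hij a ∨ e x = fullEdge hij b := fun x => hr.subset (Set.mem_range_self x)
  have h01 : e 0 ≠ e 1 := fun h => by simpa using he h
  have h0 := hlink 0
  have h1 := hlink 1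
  have hv : (v 0 = i ∧ v 1 = j) ∨ (v 0 = j ∧ v 1 = i) := by
    obtain h | h := hmem 0 <;> rw [h] at h0 <;> exact h0
  simp only [List.ofFn_succ, List.ofFn_zero, List.prod_cons, List.prod_nil, mul_one,
    Fin.succ_zero_eq_one] at hprod
  -- Depending on the starting vertex and first edge, the product is `a * b⁻¹`, `b * a⁻¹`, `a⁻¹ * b`
  -- or `b⁻¹ * a`.
  obtain ⟨hv0, hv1⟩ | ⟨hv0, hv1⟩ := hv <;> rw [hv0, hv1] at hprod <;>
  obtain h2 | h2 := hmem 0 <;> obtain h3 | h3 := hmem 1 <;> (try exact h01 (h2.trans h3.symm)) <;>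
  rw [h2, h3, fullGainGraph_gainFrom_left, fullGainGraph_gainFrom_right] at hprod
  · exact hab (mul_inv_eq_one.1 hprod)
  · exact hab (mul_inv_eq_one.1 hprod).symm
  · exact hab (inv_mul_eq_one.1 hprod)
  · exact hab (inv_mul_eq_one.1 hprod).symm

end FullGainGraph

/-! ### Lines of `M` as normal subgroups, and the rank bound. -/

section Lift

variable {n : ℕ} {Γ : Type u} [Group Γ] {M : Matroid (FullEdge n Γ)}

/-- Every balanced triangle is a circuit of `M`. -/
def TrianglesAreCircuits (M : Matroid (FullEdge n Γ)) : Prop :=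
  ∀ ⦃i j k : Fin n⦄ (hij : i < j) (hjk : j < k) (a b : Γ),
    M.IsCircuit {fullEdge hij a, fullEdge hjk b, fullEdge (hij.trans hjk) (a * b)}

/-- This and the next two lemmas are the calculus of labels in a closed set: two sides of a balanced
triangle yield the third. -/
theorem TrianglesAreCircuits.mem_mul (h : TrianglesAreCircuits M) {i j k : Fin n} (hij : i < j)
    (hjk : j < k) {a b c : Γ} {X : Set (FullEdge n Γ)} (ha : fullEdge hij a ∈ M.closure X)
    (hb : fullEdge hjk b ∈ M.closure X) (hc : a * b = c) :
    fullEdge (hij.trans hjk) c ∈ M.closure X := by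
  subst hc
  refine (h hij hjk a b).mem_closure_of_forall (by simp) ?_
  rintro f (rfl | rfl | rfl) hf
  exacts [ha, hb, absurd rfl hf]

theorem TrianglesAreCircuits.mem_left (h : TrianglesAreCircuits M) {i j k : Fin n} (hij : i < j)
    (hjk : j < k) {a b c : Γ} {X : Set (FullEdge n Γ)} (hb : fullEdge hjk b ∈ M.closure X)
    (hc : fullEdge (hij.trans hjk) c ∈ M.closure X) (habc : a * b = c) :
    fullEdge hij a ∈ M.closure X := by
  subst habc
  refine (h hij hjk a b).mem_closure_of_forall (by simp) ?_
  rintro f (rfl | rfl | rfl) hf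
  exacts [absurd rfl hf, hb, hc]

theorem TrianglesAreCircuits.mem_right (h : TrianglesAreCircuits M) {i j k : Fin n} (hij : i < j)
    (hjk : j < k) {a b c : Γ} {X : Set (FullEdge n Γ)} (ha : fullEdge hij a ∈ M.closure X)
    (hc : fullEdge (hij.trans hjk) c ∈ M.closure X) (habc : a * b = c) :
    fullEdge hjk b ∈ M.closure X := by
  subst habc
  refine (h hij hjk a b).mem_closure_of_forall (by simp) ?_
  rintro f (rfl | rfl | rfl) hf
  exacts [ha, absurd rfl hf, hc]

/-- Parallel edges with distinct labels are not parallel in `M`. -/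
theorem notMem_closure_singleton
    (hMN : ∀ X, M.closure X ⊆ (fullGainGraph n Γ).graph.cycleMatroid.closure X)
    (hbal : ∀ C : Set (FullEdge n Γ), (fullGainGraph n Γ).graph.IsCycle C →
      (M.IsCircuit C ↔ (fullGainGraph n Γ).IsBalancedCycle C))
    {i j : Fin n} (hij : i < j) {a b : Γ} (hab : a ≠ b) :
    fullEdge hij b ∉ M.closure {fullEdge hij a} := by
  intro hmem
  have hne : fullEdge hij b ≠ fullEdge hij a := fun h => hab (congrArg Prod.snd h).symm
  obtain ⟨C, hC, hCc, hbC⟩ := Matroid.exists_isCircuit_of_mem_closure hmem hne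
  by_cases haC : fullEdge hij a ∈ C
  · have hCeq : C = {fullEdge hij a, fullEdge hij b} := by
      refine Set.Subset.antisymm (fun x hx => (hC hx).symm) ?_
      rintro x (rfl | rfl) <;> assumption
    rw [hCeq, hbal _ (fullGainGraph_isCycle_digon hij hab)] at hCc
    exact fullGainGraph_not_isBalancedCycle_digon hij hab hCc
  -- The circuit would be a loop of `M`, hence of the cycle matroid, but the cut at `i` shows that
  -- no edge is one.
  · have hCeq : C = {fullEdge hij b} := by
      refine Set.Subset.antisymm (fun x hx => ?_) (by simpa using hbC)
      exact (hC hx).resolve_right fun h => haC (h ▸ hx)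
    have h := hCc.mem_closure_sdiff_singleton_of_mem hbC
    rw [hCeq, Set.sdiff_self] at h
    exact notMem_closure_of_cut {i} (by simp [hij.ne']) (by simp) (hMN _ h)

/-- The labels of the edges from `i` to `j` on the line of `M` through those with labels `1` and
`a`. -/
def lineSubgroup (h : TrianglesAreCircuits M) (hE : M.E = Set.univ)
    (hMN : ∀ X, M.closure X ⊆ (fullGainGraph n Γ).graph.cycleMatroid.closure X)
    {i j k : Fin n} (hij : i < j) (hjk : j < k) (a : Γ) : Subgroup Γ :=
  -- The auxiliary edge to `k` can be dropped again, since it alone crosses the cut at `k`.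
  have key : ∀ b : Γ, fullEdge hij b ∈ M.closure {fullEdge hij 1, fullEdge hij a} ↔
      fullEdge hij b ∈ M.closure {fullEdge hjk 1, fullEdge hij 1, fullEdge hij a} := fun b =>
    ⟨fun hb => M.closure_subset_closure (Set.subset_insert _ _) hb,
      Matroid.mem_closure_of_mem_closure_insert hMN
        (notMem_closure_of_cut {k} (by simp [hjk.ne])
          (by simp [hjk.ne, (hij.trans hjk).ne]))⟩
  have hsub : ({fullEdge hjk 1, fullEdge hij 1, fullEdge hij a} : Set (FullEdge n Γ)) ⊆
      M.closure {fullEdge hjk 1, fullEdge hij 1, fullEdge hij a} :=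
    M.subset_closure _ (by simp [hE])
  have hjk1 := hsub (Or.inl rfl)
  have hij1 := hsub (Or.inr (Or.inl rfl))
  have hik1 := h.mem_mul hij hjk hij1 hjk1 (one_mul 1)
  { carrier := {b | fullEdge hij b ∈ M.closure {fullEdge hij 1, fullEdge hij a}}
    one_mem' := (key 1).2 hij1
    mul_mem' := fun {b c} hb hc => by
      rw [Set.mem_ofPred_eq, key] at *
      -- The label `c` moves from `ij` via `ik` to `jk`; there it is multiplied by `b`, and `b * c`
      -- returns to `ij` through the edge `jk` labelled `1`.
      have h1 := h.mem_mul hij hjk hc hjk1 (mul_one c)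
      have h2 := h.mem_right hij hjk hij1 h1 (one_mul c)
      exact h.mem_left hij hjk hjk1 (h.mem_mul hij hjk hb h2 rfl) (mul_one _)
    inv_mem' := fun {b} hb => by
      rw [Set.mem_ofPred_eq, key] at *
      have h1 := h.mem_right hij hjk hb hik1 (mul_inv_cancel b)
      exact h.mem_left hij hjk hjk1 (h.mem_mul hij hjk hij1 h1 (one_mul _)) (mul_one _) }

section

variable (h : TrianglesAreCircuits M) (hE : M.E = Set.univ)
  (hMN : ∀ X, M.closure X ⊆ (fullGainGraph n Γ).graph.cycleMatroid.closure X)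
  {i j k l : Fin n} (hij : i < j) (hjk : j < k) (hkl : k < l)

theorem mem_lineSubgroup {a b : Γ} : b ∈ lineSubgroup h hE hMN hij hjk a ↔
    fullEdge hij b ∈ M.closure {fullEdge hij 1, fullEdge hij a} := Iff.rfl

theorem self_mem_lineSubgroup (a : Γ) : a ∈ lineSubgroup h hE hMN hij hjk a :=
  M.mem_closure_of_mem' (by simp) (by simp [hE])

/-- Membership in a line can be tested on a disjoint pair of vertices, and up to conjugation. -/
theorem mem_lineSubgroup_iff {a b : Γ} (g : Γ) : b ∈ lineSubgroup h hE hMN hij hjk a ↔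
    fullEdge hkl (g⁻¹ * b * g) ∈ M.closure {fullEdge hkl 1, fullEdge hij 1, fullEdge hij a} := by
  have hik := hij.trans hjk
  have hjl := hjk.trans hkl
  have hil := hij.trans hjl
  -- An auxiliary edge `jk` labelled `g` sends the label `b` on `ij` to `b * g` on `ik` and `il`,
  -- and to `g⁻¹ * b * g` on `kl`. It is then removed, so the spanning set on the right does not
  -- depend on `g`.
  have hsub : ({fullEdge hjk g, fullEdge hkl 1, fullEdge hij 1, fullEdge hij a} :
      Set (FullEdge n Γ)) ⊆
      M.closure {fullEdge hjk g, fullEdge hkl 1, fullEdge hij 1, fullEdge hij a} :=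
    M.subset_closure _ (by simp [hE])
  have hjkg := hsub (Or.inl rfl)
  have hkl1 := hsub (Or.inr (Or.inl rfl))
  have hij1 := hsub (Or.inr (Or.inr (Or.inl rfl)))
  have hikg := h.mem_mul hij hjk hij1 hjkg (one_mul g)
  rw [mem_lineSubgroup]
  constructor
  · intro hb
    have hb' := M.closure_subset_closure
      ((Set.subset_insert (fullEdge hkl 1) _).trans (Set.subset_insert (fullEdge hjk g) _)) hb
    refine Matroid.mem_closure_of_mem_closure_insert hMN (z := fullEdge hjk g)
      (notMem_closure_of_cut {k, l} ?_ ?_) ?_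
    · simp [hjk.ne, hjl.ne]
    · simp [hik.ne, hil.ne, hjk.ne, hjl.ne]
    · have h1 := h.mem_mul hij hjk hb' hjkg rfl
      have h2 := h.mem_mul hik hkl h1 hkl1 (mul_one _)
      exact h.mem_right hik hkl hikg h2 (by group)
  · intro hb
    have hb' := M.closure_subset_closure (Set.subset_insert (fullEdge hjk g) _) hb
    have h1 := h.mem_mul hik hkl hikg hb' rfl
    have h2 := h.mem_left hik hkl hkl1 h1 (mul_one _)
    have h3 : fullEdge hij b ∈ M.closure _ := h.mem_left hij hjk hjkg h2 (by group)
    refine Matroid.mem_closure_of_mem_closure_insert hMN (z := fullEdge hkl 1)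
      (notMem_closure_of_cut {l} ?_ ?_) (Matroid.mem_closure_of_mem_closure_insert hMN
        (z := fullEdge hjk g) (notMem_closure_of_cut {k, l} ?_ ?_) h3)
    · simp [hkl.ne]
    · simp [hil.ne, hjl.ne]
    · simp [hjk.ne, hjl.ne]
    · simp [hik.ne, hil.ne, hjk.ne, hjl.ne]

/-- Testing `b` with conjugator `1` and `g * b * g⁻¹` with conjugator `g` asks about the same edge
`kl` and the same closure. -/
theorem lineSubgroup_normal (hkl : k < l) (a : Γ) : (lineSubgroup h hE hMN hij hjk a).Normal := by
  refine ⟨fun b hb g => ?_⟩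
  have h1 := mem_lineSubgroup_iff h hE hMN hij hjk hkl (a := a) (b := b) 1
  have h2 := mem_lineSubgroup_iff h hE hMN hij hjk hkl (a := a) (b := g * b * g⁻¹) g
  rw [show g⁻¹ * (g * b * g⁻¹) * g = 1⁻¹ * b * 1 by group] at h2
  exact h2.2 (h1.1 hb)

/-- Two points of a line that are not parallel in `M` span it, by exchange. -/
theorem lineSubgroup_eq
    (hbal : ∀ C : Set (FullEdge n Γ), (fullGainGraph n Γ).graph.IsCycle C →
      (M.IsCircuit C ↔ (fullGainGraph n Γ).IsBalancedCycle C))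
    {a b : Γ} (hb1 : b ≠ 1) (hb : b ∈ lineSubgroup h hE hMN hij hjk a) :
    lineSubgroup h hE hMN hij hjk b = lineSubgroup h hE hMN hij hjk a := by
  have hnot := notMem_closure_singleton hMN hbal hij hb1.symm
  rw [mem_lineSubgroup, Set.pair_comm] at hb
  ext c
  rw [mem_lineSubgroup, mem_lineSubgroup, Set.pair_comm, Set.pair_comm (fullEdge hij 1) _,
    M.closure_insert_congr ⟨hb, hnot⟩]

end

/-- The edges with label `1` at the first vertex. -/
def identityStar (n : ℕ) [NeZero n] (Γ : Type u) [Group Γ] : Set (FullEdge n Γ) :=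
  Set.range fun j : {j : Fin n // 0 < j} => fullEdge j.2 1

/-- Each edge of the star is the only one crossing the cut at its outer end. -/
theorem identityStar_indep [NeZero n] :
    (fullGainGraph n Γ).graph.cycleMatroid.Indep (identityStar n Γ) := by
  rw [Matroid.indep_iff_forall_notMem_closure_sdiff (Set.subset_univ _)]
  rintro _ ⟨j, rfl⟩
  refine notMem_closure_of_cut {j.1} (by simp [j.2.ne]) ?_
  rintro _ ⟨⟨x, rfl⟩, hx⟩
  have hxj : x.1 ≠ j.1 := by
    intro h
    rw [Subtype.ext h] at hx
    exact hx rfl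
  simp [j.2.ne, hxj]

/-- If the line of `M` through two parallel edges contains all edges parallel to them, then `M` is
spanned by one more element than the cycle matroid. -/
theorem eRank_le_of_line [NeZero n] (h : TrianglesAreCircuits M) (hE : M.E = Set.univ)
    {i : Fin n} (hi : 0 < i) {a : Γ}
    (ha : ∀ b, fullEdge hi b ∈ M.closure {fullEdge hi 1, fullEdge hi a}) :
    M.eRank ≤ (fullGainGraph n Γ).graph.cycleMatroid.eRank + 1 := by
  set X := insert (fullEdge hi a) (identityStar n Γ) with hX
  have hsub : X ⊆ M.closure X := M.subset_closure _ (by simp [hE])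
  have hstar : ∀ {j : Fin n} (hj : 0 < j), fullEdge hj 1 ∈ M.closure X := fun {j} hj =>
    hsub (Or.inr ⟨⟨j, hj⟩, rfl⟩)
  have hline : ∀ b, fullEdge hi b ∈ M.closure X := fun b => by
    refine M.closure_subset_closure ?_ (ha b)
    rintro _ (rfl | rfl)
    exacts [Or.inr ⟨⟨i, hi⟩, rfl⟩, Or.inl rfl]
  -- The star spans the edge labelled `1` between `i` and `j`, which carries every label from `0i`
  -- to `0j`.
  have hfirst : ∀ {j : Fin n} (hj : 0 < j) (b : Γ), fullEdge hj b ∈ M.closure X := by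
    intro j hj b
    obtain hji | rfl | hij := lt_trichotomy j i
    · exact h.mem_left hj hji (h.mem_right hj hji (hstar hj) (hstar hi) (one_mul 1)) (hline b)
        (mul_one b)
    · exact hline b
    · exact h.mem_mul hi hij (hline b) (h.mem_right hi hij (hstar hi) (hstar hj) (one_mul 1))
        (mul_one b)
  have hall : M.E ⊆ M.closure X := by
    rintro ⟨⟨⟨j, k⟩, hjk⟩, b⟩ -
    change fullEdge hjk b ∈ _
    obtain hj | hj := (Fin.zero_le j).eq_or_lt
    · subst hj
      exact hfirst hjk b
    · exact h.mem_right hj hjk (hstar hj) (hfirst (hj.trans hjk) b) (one_mul b)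
  calc M.eRank = M.eRk M.E := M.eRank_def
    _ ≤ M.eRk (M.closure X) := M.eRk_mono hall
    _ = M.eRk X := M.eRk_closure_eq X
    _ ≤ X.encard := M.eRk_le_encard X
    _ ≤ (identityStar n Γ).encard + 1 := Set.encard_insert_le _ _
    _ ≤ _ := by gcongr; exact identityStar_indep.encard_le_eRank

end Lift

/-! ### Assembly on the first four vertices. -/

theorem mainTheorem5 (n : ℕ) (hn : 4 ≤ n) (Γ : Type u) [Group Γ] [Finite Γ]
    (M : Matroid (FullEdge n Γ))
    (hlift : M.IsLift (fullGainGraph n Γ).graph.cycleMatroid)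
    (hbal : ∀ C : Set (FullEdge n Γ), (fullGainGraph n Γ).graph.IsCycle C →
      (M.IsCircuit C ↔ (fullGainGraph n Γ).IsBalancedCycle C))
    (hrank : (fullGainGraph n Γ).graph.cycleMatroid.eRank + 1 < M.eRank) :
    ∃ p j : ℕ, p.Prime ∧ 2 ≤ j ∧ Nonempty (Γ ≃* Multiplicative (Fin j → ZMod p)) := by
  have : NeZero n := ⟨by omega⟩
  have hE : M.E = Set.univ := hlift.ground_eq
  have hMN := hlift.closure_subset
  have htri : TrianglesAreCircuits M := by
    intro i j k hij hjk a b
    have hbc := fullGainGraph_isBalancedCycle_triangle hij hjk a b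
    exact (hbal _ (hbc.imp fun m ⟨v, e, hve, hr, _⟩ => ⟨v, e, hve, hr⟩)).2 hbc
  have h01 : (0 : Fin n) < ⟨1, by omega⟩ := by simp [Fin.lt_def]
  have h12 : (⟨1, by omega⟩ : Fin n) < ⟨2, by omega⟩ := by simp
  have h23 : (⟨2, by omega⟩ : Fin n) < ⟨3, by omega⟩ := by simp
  refine exists_mulEquiv_of_normal_partition (lineSubgroup htri hE hMN h01 h12)
    (lineSubgroup_normal htri hE hMN h01 h12 h23) (self_mem_lineSubgroup htri hE hMN h01 h12)
    (fun a ha => ?_) fun a b hb1 hb => lineSubgroup_eq htri hE hMN h01 h12 hbal hb1 hb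
  -- The rank hypothesis enters only here, to make every line subgroup proper.
  refine hrank.not_ge (eRank_le_of_line htri hE h01 (a := a) fun b => ?_)
  rw [← mem_lineSubgroup htri hE hMN h01 h12, ha]
  exact Subgroup.mem_top b
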